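/- Let $F$ be a field, let $D$ be a subring of $F$ (whose quotient field need not be $F$), and let $\mathfrak X$ be the Zariski–Riemann space of $F/D$: the set of all valuation rings $V$ of $F$ (subrings $V\subseteq F$ such that $x\in V$ or $x^{-1}\in V$ for every nonzero $x\in F$) that contain $D$, with the topology whose basic open sets are $\{V\in\mathfrak X: t_1,\dots,t_n\in V\}$ for $t_1,\dots,t_n\in F$. Let $Z\subseteq\mathfrak X$ be a subspace with $F\in Z$, and let $A=\bigcap_{V\in Z}V$. Regard $Z$ as a locally ringed space with structure sheaf $\mathcal O_Z(U)=\bigcap_{V\in U}V$ for nonempty open $U\subseteq Z$ and $\mathcal O_Z(\emptyset)=0$, and with the structure morphism $Z\to\operatorname{Spec}(D)$ that sends $V$ to its center in $D$ and is given on sections by inclusion. Let $\mathbb P^1_D=\operatorname{Proj}(D[T_0,T_1])$; a $D$-morphism $Z\to\mathbb P^1_D$ is a morphism of locally ringed spaces that is compatible with the structure morphisms to $\operatorname{Spec}(D)$. Suppose that for each $D$-morphism $\phi:Z\to\mathbb P^1_D$ there is a homogeneous polynomial $f\in D[T_0,T_1]$ of positive degree such that the image of $\phi$ is contained in the open set $(\mathbb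 P^1_D)_f$ of homogeneous primes not containing $f$. Then $A$ is a Prüfer domain (that is, $A_P$ is a valuation ring for every prime ideal $P$ of $A$) with torsion Picard group and with quotient field $F$. -/

import Mathlib

open CategoryTheory TopologicalSpace Opposite AlgebraicGeometry

universe u

namespace ZR

/-- The Zariski-Riemann space of `F / D`: all valuation rings of `F` that contain the
subring `D`. -/
def Space {F : Type u} [Field F] (D : Subring F) : Type u :=
  {V : ValuationSubring F // D ≤ V.toSubring}

/-- The Zariski topology, whose basic open sets are `{V : t₁, …, tₙ ∈ V}`. -/
instance {F : Type u} [Field F] (D : Subring F) : TopologicalSpace (Space D) :=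
  TopologicalSpace.generateFrom {U | ∃ t : Finset F, U = {V : Space D | ∀ x ∈ t, x ∈ V.1}}

/-- The field `F` itself, as a point of the Zariski-Riemann space. -/
def Space.generic {F : Type u} [Field F] (D : Subring F) : Space D :=
  ⟨⊤, fun _ _ => ValuationSubring.mem_top _⟩

theorem isOpen_setOf_mem {F : Type u} [Field F] (D : Subring F) (t : F) :
    IsOpen {V : Space D | t ∈ V.1} :=
  isOpen_generateFrom_of_mem ⟨{t}, by simp⟩

/-- The field `F` lies in every nonempty open set. -/
theorem generic_mem {F : Type u} [Field F] {D : Subring F} {U : Set (Space D)} (hU : IsOpen U)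
    {V : Space D} (hV : V ∈ U) : Space.generic D ∈ U := by
  induction hU generalizing V with
  | basic s hs =>
    obtain ⟨t, rfl⟩ := hs
    exact fun x _ => ValuationSubring.mem_top x
  | univ => trivial
  | inter s t _ _ hs ht => exact ⟨hs hV.1, ht hV.2⟩
  | sUnion S _ h =>
    obtain ⟨s, hs, hVs⟩ := hV
    exact ⟨s, hs, h s hs hVs⟩

theorem generic_mem_opens {F : Type u} [Field F] {D : Subring F} {Z : Set (Space D)}
    (hZ : Space.generic D ∈ Z) (U : Opens (TopCat.of Z)) {V : TopCat.of Z} (hV : V ∈ U) :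
    (⟨Space.generic D, hZ⟩ : TopCat.of Z) ∈ U := by
  obtain ⟨W, hW, hWU⟩ := isOpen_induced_iff.mp U.2
  have h1 : V.1 ∈ W := by
    have : V ∈ (Subtype.val ⁻¹' W : Set Z) := by rw [hWU]; exact hV
    exact this
  have h2 := generic_mem hW h1
  have : (⟨Space.generic D, hZ⟩ : Z) ∈ (Subtype.val ⁻¹' W : Set Z) := h2
  rw [hWU] at this
  exact this

/-- The holomorphy ring `A = ⋂_{V ∈ Z} V` of a subspace `Z`. -/
def holomorphyRing {F : Type u} [Field F] {D : Subring F} (Z : Set (Space D)) : Subring F :=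
  ⨅ V ∈ Z, V.1.toSubring

section sheaf

variable {F : Type u} [Field F] {D : Subring F} (Z : Set (Space D))

/-- The ring of sections of the holomorphy sheaf of `Z` over an open set `U`: constant functions
on `U` whose value lies in every `V ∈ U`. For nonempty `U` this is the ring `⋂_{V ∈ U} V`
(`sectionsEquiv`), and for empty `U` it is the trivial ring (`sections_subsingleton`). -/
def sections (U : Opens (TopCat.of Z)) : Subring (U → F) where
  carrier := {s | ∃ a : F, ∀ V : U, a ∈ V.1.1.1 ∧ s V = a}
  zero_mem' := ⟨0, fun V => ⟨zero_mem _, rfl⟩⟩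
  one_mem' := ⟨1, fun V => ⟨one_mem _, rfl⟩⟩
  add_mem' := by
    rintro s t ⟨a, ha⟩ ⟨b, hb⟩
    exact ⟨a + b, fun V => ⟨add_mem (ha V).1 (hb V).1, congrArg₂ _ (ha V).2 (hb V).2⟩⟩
  mul_mem' := by
    rintro s t ⟨a, ha⟩ ⟨b, hb⟩
    exact ⟨a * b, fun V => ⟨mul_mem (ha V).1 (hb V).1, congrArg₂ _ (ha V).2 (hb V).2⟩⟩
  neg_mem' := by
    rintro s ⟨a, ha⟩
    exact ⟨-a, fun V => ⟨neg_mem (ha V).1, congrArg _ (ha V).2⟩⟩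

/-- The constant section with value `a`. -/
def constSection (U : Opens (TopCat.of Z)) (a : F) (ha : ∀ V : U, a ∈ V.1.1.1) : sections Z U :=
  ⟨fun _ => a, a, fun V => ⟨ha V, rfl⟩⟩

/-- Over a nonempty open set `U` the ring of sections is `⋂_{V ∈ U} V`. -/
def sectionsEquiv (U : Opens (TopCat.of Z)) (V₀ : U) :
    sections Z U ≃+* (⨅ V : U, V.1.1.1.toSubring : Subring F) where
  toFun s := ⟨s.1 V₀, by
    obtain ⟨s, a, ha⟩ := s
    rw [Subring.mem_iInf]
    intro V
    change s V₀ ∈ _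
    rw [(ha V₀).2]
    exact (ha V).1⟩
  invFun a := constSection Z U a.1 fun V => Subring.mem_iInf.mp a.2 V
  left_inv := by
    rintro ⟨s, a, ha⟩
    refine Subtype.ext (funext fun V => ?_)
    change s V₀ = s V
    rw [(ha V₀).2, (ha V).2]
  right_inv _ := rfl
  map_mul' _ _ := rfl
  map_add' _ _ := rfl

theorem sections_subsingleton (U : Opens (TopCat.of Z)) (hU : IsEmpty U) :
    Subsingleton (sections Z U) :=
  ⟨fun _ _ => Subtype.ext (funext fun V => hU.elim V)⟩

/-- Restriction of sections. -/
def restrict {U W : Opens (TopCat.of Z)} (h : W ≤ U) : sections Z U →+* sections Z W where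
  toFun s := ⟨fun V => s.1 ⟨V.1, h V.2⟩, by
    obtain ⟨s, a, ha⟩ := s
    exact ⟨a, fun V => ha ⟨V.1, h V.2⟩⟩⟩
  map_zero' := rfl
  map_one' := rfl
  map_add' _ _ := rfl
  map_mul' _ _ := rfl

/-- The holomorphy presheaf of `Z`. -/
def presheaf : TopCat.Presheaf CommRingCat.{u} (TopCat.of Z) where
  obj U := CommRingCat.of (sections Z U.unop)
  map i := CommRingCat.ofHom (restrict Z i.unop.le)

/-- The holomorphy presheaf is a sheaf as soon as `F ∈ Z`. -/
theorem presheaf_isSheaf (hZ : Space.generic D ∈ Z) : (presheaf Z).IsSheaf := by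
  rw [TopCat.Presheaf.isSheaf_iff_isSheafUniqueGluing]
  intro ι U sf hsf
  replace hsf : ∀ (i j : ι) (V : TopCat.of Z) (hi : V ∈ U i) (hj : V ∈ U j),
      (sf i : sections Z (U i)).1 ⟨V, hi⟩ = (sf j : sections Z (U j)).1 ⟨V, hj⟩ :=
    fun i j V hi hj =>
      congrFun (congrArg (fun s : sections Z (U i ⊓ U j) => s.1) (hsf i j)) ⟨V, hi, hj⟩
  have key : ∀ (i j : ι) (V : U i) (W : U j),
      (sf i : sections Z (U i)).1 V = (sf j : sections Z (U j)).1 W := by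
    intro i j V W
    obtain ⟨a, ha⟩ := (sf i : sections Z (U i)).2
    obtain ⟨b, hb⟩ := (sf j : sections Z (U j)).2
    rw [(ha V).2, (hb W).2, ← (ha ⟨_, generic_mem_opens hZ (U i) V.2⟩).2,
      ← (hb ⟨_, generic_mem_opens hZ (U j) W.2⟩).2]
    exact hsf i j _ _ _
  have hmem : ∀ V : (iSup U : Opens (TopCat.of Z)), ∃ i, V.1 ∈ U i := fun V => Opens.mem_iSup.mp V.2
  have ex : ∃ s : sections Z (iSup U), ∀ (i : ι) (V : TopCat.of Z) (hi : V ∈ U i)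
      (h : V ∈ iSup U), s.1 ⟨V, h⟩ = (sf i : sections Z (U i)).1 ⟨V, hi⟩ := by
    by_cases hne : Nonempty (iSup U : Opens (TopCat.of Z))
    · obtain ⟨V₀⟩ := hne
      obtain ⟨i₀, hi₀⟩ := hmem V₀
      refine ⟨constSection Z _ ((sf i₀ : sections Z (U i₀)).1 ⟨V₀.1, hi₀⟩) fun V => ?_,
        fun i V hi h => key _ _ _ _⟩
      obtain ⟨i, hi⟩ := hmem V
      rw [key i₀ i ⟨V₀.1, hi₀⟩ ⟨V.1, hi⟩]
      obtain ⟨a, ha⟩ := (sf i : sections Z (U i)).2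
      rw [(ha ⟨V.1, hi⟩).2]
      exact (ha ⟨V.1, hi⟩).1
    · exact ⟨0, fun i V hi h => absurd ⟨⟨V, h⟩⟩ hne⟩
  obtain ⟨s, hs⟩ := ex
  refine ⟨s, fun i => ?_, fun t ht => ?_⟩
  · exact Subtype.ext (funext fun V => hs i V.1 V.2 (Opens.mem_iSup.mpr ⟨i, V.2⟩))
  · refine Subtype.ext (funext fun V => ?_)
    obtain ⟨i, hi⟩ := hmem V
    rw [hs i V.1 hi V.2]
    exact congrFun (congrArg (fun s : sections Z (U i) => s.1) (ht i)) ⟨V.1, hi⟩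

theorem isUnit_germ (V : TopCat.of Z) (U : Opens (TopCat.of Z)) (hV : V ∈ U) (s : sections Z U)
    (h0 : s.1 ⟨V, hV⟩ ≠ 0) (hinv : (s.1 ⟨V, hV⟩)⁻¹ ∈ V.1.1) :
    IsUnit ((presheaf Z).germ U V hV s) := by
  obtain ⟨a, ha⟩ := s.2
  have haV := (ha ⟨V, hV⟩).2
  rw [haV] at h0 hinv
  let W : Opens (TopCat.of Z) :=
    U ⊓ ⟨{x : Z | a⁻¹ ∈ x.1.1}, (isOpen_setOf_mem D a⁻¹).preimage continuous_subtype_val⟩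
  have hVW : V ∈ W := ⟨hV, hinv⟩
  have hWU : W ≤ U := inf_le_left
  have e : (presheaf Z).germ W V hVW (restrict Z hWU s) = (presheaf Z).germ U V hV s :=
    (presheaf Z).germ_res_apply (homOfLE hWU) V hVW s
  rw [← e]
  have hu : IsUnit (restrict Z hWU s) := by
    refine IsUnit.of_mul_eq_one (constSection Z W a⁻¹ fun x => x.2.2) ?_
    refine Subtype.ext (funext fun x => ?_)
    change s.1 ⟨x.1, hWU x.2⟩ * a⁻¹ = 1
    rw [(ha _).2, mul_inv_cancel₀ h0]
  exact hu.map ((presheaf Z).germ W V hVW).hom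

/-- If two sections have the same germ at `V`, they have the same value at `V`. -/
theorem eq_of_germ_eq (V : TopCat.of Z) (U U' : Opens (TopCat.of Z)) (hV : V ∈ U) (hV' : V ∈ U')
    (s : sections Z U) (s' : sections Z U')
    (h : (presheaf Z).germ U V hV s = (presheaf Z).germ U' V hV' s') :
    s.1 ⟨V, hV⟩ = s'.1 ⟨V, hV'⟩ := by
  obtain ⟨W, hW, i, j, hij⟩ := (presheaf Z).germ_eq V hV hV' _ _ h
  exact congrFun (congrArg (fun s : sections Z W => s.1) hij) ⟨V, hW⟩

/-- The stalks of the holomorphy presheaf are local rings. -/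
theorem isLocalRing_stalk (V : TopCat.of Z) : IsLocalRing ((presheaf Z).stalk V) := by
  have hunit := isUnit_germ Z V
  have : Nontrivial ((presheaf Z).stalk V) := by
    refine ⟨0, 1, fun h => ?_⟩
    have h' : (presheaf Z).germ ⊤ V trivial (0 : sections Z ⊤) =
        (presheaf Z).germ ⊤ V trivial (1 : sections Z ⊤) :=
      ((map_zero ((presheaf Z).germ ⊤ V trivial).hom).trans h).trans
        (map_one ((presheaf Z).germ ⊤ V trivial).hom).symm
    exact zero_ne_one (eq_of_germ_eq Z V ⊤ ⊤ trivial trivial 0 1 h' : (0 : F) = 1)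
  refine IsLocalRing.of_isUnit_or_isUnit_one_sub_self fun x => ?_
  obtain ⟨U, hV, s, rfl⟩ := (presheaf Z).exists_germ_eq x
  change sections Z U at s
  obtain ⟨a, ha⟩ := s.2
  have haV := ha ⟨V, hV⟩
  have e : (1 : (presheaf Z).stalk V) - (presheaf Z).germ U V hV s =
      (presheaf Z).germ U V hV (1 - s : sections Z U) := by
    have h1 := map_sub ((presheaf Z).germ U V hV).hom (1 : sections Z U) s
    have h2 := map_one ((presheaf Z).germ U V hV).hom
    exact (congrArg (· - _) h2.symm).trans h1.symm
  rw [e]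
  have hinv : ∀ b : V.1.1, IsUnit b → b.1 ≠ 0 ∧ b.1⁻¹ ∈ V.1.1 := by
    intro b hb
    obtain ⟨c, hc⟩ := hb.exists_right_inv
    have hc' : b.1 * c.1 = 1 := congrArg Subtype.val hc
    refine ⟨left_ne_zero_of_mul_eq_one hc', ?_⟩
    rw [inv_eq_of_mul_eq_one_right hc']
    exact c.2
  rcases IsLocalRing.isUnit_or_isUnit_one_sub_self (⟨a, haV.1⟩ : V.1.1) with hb | hb
  · obtain ⟨h0, h1⟩ := hinv _ hb
    left
    refine hunit U hV s ?_ ?_ <;> rw [haV.2] <;> assumption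
  · obtain ⟨h0, h1⟩ := hinv _ hb
    right
    have e2 : (1 - s : sections Z U).1 ⟨V, hV⟩ = 1 - a := by rw [← haV.2]; rfl
    refine hunit U hV (1 - s) ?_ ?_ <;> rw [e2] <;> assumption

/-- `Z` as a locally ringed space, with the holomorphy sheaf as structure sheaf. -/
noncomputable def toLRS (hZ : Space.generic D ∈ Z) : LocallyRingedSpace.{u} where
  carrier := TopCat.of Z
  presheaf := presheaf Z
  IsSheaf := presheaf_isSheaf Z hZ
  isLocalRing := isLocalRing_stalk Z

/-- The inclusion of `D` into the ring of global sections of `Z`. -/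
def toGlobalSections (hZ : Space.generic D ∈ Z) :
    CommRingCat.of D ⟶ LocallyRingedSpace.Γ.obj (op (toLRS Z hZ)) :=
  CommRingCat.ofHom (S := sections Z ⊤)
    { toFun := fun d => constSection Z ⊤ d.1 fun V => V.1.1.2 d.2
      map_zero' := rfl
      map_one' := rfl
      map_add' := fun _ _ => rfl
      map_mul' := fun _ _ => rfl }

/-- The structure morphism `Z ⟶ Spec D`: the unique morphism of locally ringed spaces that induces
the inclusion of `D` on global sections. On points it sends a valuation ring to its center in `D`
(`mem_structureMorphism_base`), and on sections it is inclusion (`structureMorphism_app`). -/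
noncomputable def structureMorphism (hZ : Space.generic D ∈ Z) :
    toLRS Z hZ ⟶ (Spec (CommRingCat.of D)).toLocallyRingedSpace :=
  (toLRS Z hZ).toΓSpec ≫ Spec.locallyRingedSpaceMap (toGlobalSections Z hZ)

/-- The point map of the structure morphism sends `V` to the center of `V` in `D`. -/
theorem mem_structureMorphism_base (hZ : Space.generic D ∈ Z) (V : Z) (d : D) :
    d ∈ ((structureMorphism Z hZ).base V : PrimeSpectrum D).asIdeal ↔
      (⟨d.1, V.1.2 d.2⟩ : V.1.1) ∈ IsLocalRing.maximalIdeal V.1.1 := by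
  let s : sections Z ⊤ := constSection Z ⊤ d.1 fun W => W.1.1.2 d.2
  have h1 : d ∈ ((structureMorphism Z hZ).base V : PrimeSpectrum D).asIdeal ↔
      ¬ IsUnit ((presheaf Z).germ ⊤ V trivial s) := Iff.rfl
  rw [h1, IsLocalRing.mem_maximalIdeal, mem_nonunits_iff, not_iff_not]
  constructor
  · intro h
    obtain ⟨y, hy⟩ := h.exists_right_inv
    obtain ⟨U, hV, t, rfl⟩ := (presheaf Z).exists_germ_eq y
    change sections Z U at t
    have e : (presheaf Z).germ ⊤ V trivial s = (presheaf Z).germ U V hV (restrict Z le_top s) :=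
      ((presheaf Z).germ_res_apply (homOfLE le_top) V hV s).symm
    rw [e] at hy
    have hy' : (presheaf Z).germ U V hV (restrict Z le_top s * t : sections Z U) =
        (presheaf Z).germ U V hV (1 : sections Z U) :=
      ((map_mul ((presheaf Z).germ U V hV).hom _ _).trans hy).trans
        (map_one ((presheaf Z).germ U V hV).hom).symm
    have hst : d.1 * t.1 ⟨V, hV⟩ = 1 := eq_of_germ_eq Z V U U hV hV _ _ hy'
    obtain ⟨a, ha⟩ := t.2
    have hmem : t.1 ⟨V, hV⟩ ∈ V.1.1 := by
      rw [(ha ⟨V, hV⟩).2]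
      exact (ha ⟨V, hV⟩).1
    exact IsUnit.of_mul_eq_one ⟨_, hmem⟩ (Subtype.ext hst)
  · intro h
    obtain ⟨c, hc⟩ := h.exists_right_inv
    have hc' : d.1 * c.1 = 1 := congrArg Subtype.val hc
    refine isUnit_germ Z V ⊤ trivial s (left_ne_zero_of_mul_eq_one hc') ?_
    change d.1⁻¹ ∈ _
    rw [inv_eq_of_mul_eq_one_right hc']
    exact c.2

/-- On sections over any open set, the structure morphism restricts to the inclusion of `D`. -/
theorem structureMorphism_app (hZ : Space.generic D ∈ Z)
    (U : (Opens (PrimeSpectrum D))ᵒᵖ) :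
    CommRingCat.ofHom (algebraMap D ((Spec.structureSheaf D).obj.obj U)) ≫
        (structureMorphism Z hZ).c.app U =
      toGlobalSections Z hZ ≫ (toLRS Z hZ).presheaf.map (homOfLE le_top).op :=
  ΓSpec.toOpen_comp_locallyRingedSpaceAdjunction_homEquiv_app (toGlobalSections Z hZ).op U

end sheaf

attribute [local instance] MvPolynomial.gradedAlgebra

/-- The projective line `ℙ¹_D = Proj D[T₀, T₁]`. -/
noncomputable abbrev P1 (D : Type u) [CommRing D] : Scheme.{u} :=
  Proj (MvPolynomial.homogeneousSubmodule (Fin 2) D)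

/-- The structure morphism `ℙ¹_D ⟶ Spec D`. -/
noncomputable def P1.structureMorphism (D : Type u) [CommRing D] :
    P1 D ⟶ Spec (CommRingCat.of D) :=
  Proj.toSpecZero (MvPolynomial.homogeneousSubmodule (Fin 2) D) ≫
    Spec.map (CommRingCat.ofHom
      (algebraMap D (MvPolynomial.homogeneousSubmodule (Fin 2) D 0)))

/-- The open subset `(ℙ¹_D)_f` of `ℙ¹_D`: the homogeneous primes that do not contain `f`. -/
noncomputable def P1.basicOpen {D : Type u} [CommRing D] (f : MvPolynomial (Fin 2) D) :
    (P1 D).Opens :=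
  Proj.basicOpen (MvPolynomial.homogeneousSubmodule (Fin 2) D) f

/-- `D`-morphisms `Z ⟶ ℙ¹_D`: morphisms of locally ringed spaces over `Spec D`. -/
def IsDMorphism {F : Type u} [Field F] {D : Subring F} {Z : Set (Space D)}
    {hZ : Space.generic D ∈ Z} (φ : toLRS Z hZ ⟶ (P1 D).toLocallyRingedSpace) : Prop :=
  φ ≫ (P1.structureMorphism D).toLRSHom = structureMorphism Z hZ

/-- A domain is a Prüfer domain if its localization at each prime ideal is a valuation ring. -/
def IsPruferDomain (A : Type u) [CommRing A] [IsDomain A] : Prop :=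
  ∀ (P : Ideal A) [P.IsPrime], ValuationRing (Localization.AtPrime P)

end ZR

/-! Everything reduces to one property of `A`: for each `t` in `F` some power `(1, t)^d = (1, t, …,
t^d)`, with `d > 0`, of the fractional ideal `(1, t)` is principal.

To obtain it, send `V` to the image in `ℙ¹_D` of the closed point of `Spec V` under `[1 : t]`. This
is possible because dividing `(1, t)` by whichever entry has the smaller value makes it unimodular
over `V`. The result is a `D`-morphism on `Z` (`pointHom`, `isDMorphism_pointHom`). For `f`
homogeneous of degree `d`, the image of `V` avoids the zeros of `f` exactly when `c = f(1, t)` is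
nonzero and `t^i / c ∈ V` for all `i ≤ d` (`notMem_point_iff`). If this holds on all of `Z`, every
`t^i` lies in `cA`; since `c` is a combination of the `t^i` over `D ⊆ A`, `(1, t)^d = cA`.

The rest is algebra. `t = (t / c) / (1 / c)` is a fraction over `A`. The elements `t^i / c` generate
the unit ideal, so at each prime one of them is a unit, and its ratio to a neighbour puts `t` or
`t⁻¹` in the localization: `A` is Prüfer. In a Prüfer domain `(I + J)^n = I^n + J^n`, so principal
powers pass from ideals with two generators to all finitely generated ones, in particular to
invertible ones. -/

namespace ZR

/-! ### Principal powers of ideals, the Prüfer property and torsion in the Picard group -/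

/-- Every fractional ideal `(1, t)` of `A` has a principal power: there are `d > 0` and `c ≠ 0`
such that `c` is an `A`-linear combination of `1, t, …, tᵈ` and divides each of these. -/
def HasPrincipalPowers {F : Type u} [Field F] (A : Subring F) : Prop :=
  ∀ t : F, ∃ d : ℕ, 0 < d ∧ ∃ c : F, c ≠ 0 ∧ (∀ i ≤ d, t ^ i / c ∈ A) ∧
    ∃ e : ℕ → A, ∑ i ∈ Finset.range (d + 1), (e i : F) * t ^ i = c

namespace HasPrincipalPowers

variable {F : Type u} [Field F] {A : Subring F} (hA : HasPrincipalPowers A)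

include hA

theorem isFractionRing : IsFractionRing A F := by
  refine IsFractionRing.of_field A F fun t => ?_
  obtain ⟨d, hd, c, hc, hmem, -⟩ := hA t
  refine ⟨⟨_, hmem 1 hd⟩, ⟨_, hmem 0 d.zero_le⟩, ?_⟩
  change t = (t ^ 1 / c) / (t ^ 0 / c)
  field_simp

/-- This is comparability of `a` and `b` in `A_P`, with denominators cleared. With `t = b / a`, the
elements `u i = t^i / c` generate the unit ideal, so one of them avoids `P`; multiplication by `t`
moves `u i` to `u (i + 1)`. -/
theorem exists_notMem_mul_eq (P : Ideal A) [P.IsPrime] (a b : A) :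
    ∃ s ∉ P, ∃ r : A, s * b = r * a ∨ s * a = r * b := by
  by_cases ha : a = 0
  · exact ⟨1, Ideal.one_notMem P, 0, Or.inr (by simp [ha])⟩
  have ha' : (a : F) ≠ 0 := fun h => ha (Subtype.ext h)
  obtain ⟨d, hd, c, hc, hmem, e, he⟩ := hA (b / a)
  let u : ℕ → A := fun i => if h : i ≤ d then ⟨_, hmem i h⟩ else 0
  have hu : ∀ i ≤ d, (u i : F) = (b / a) ^ i / c := fun i hi => by simp [u, hi]
  have hsum : ∑ i ∈ Finset.range (d + 1), e i * u i = 1 := by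
    refine Subtype.ext ?_
    push_cast
    rw [← div_self hc, ← he, Finset.sum_div]
    refine Finset.sum_congr rfl fun i hi => ?_
    rw [hu i (Nat.lt_succ_iff.mp (Finset.mem_range.mp hi)), he, mul_div_assoc]
  obtain ⟨i, hi, hiP⟩ : ∃ i ≤ d, u i ∉ P := by
    by_contra! hcon
    refine Ideal.one_notMem P (hsum ▸ Ideal.sum_mem _ fun i hi => ?_)
    exact Ideal.mul_mem_left _ _ (hcon i (Nat.lt_succ_iff.mp (Finset.mem_range.mp hi)))
  rcases hi.lt_or_eq with h | rfl
  · refine ⟨u i, hiP, u (i + 1), Or.inl (Subtype.ext ?_)⟩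
    push_cast
    rw [hu i hi, hu (i + 1) h, pow_succ]
    field_simp
  -- At the top index there is no successor, so the predecessor is used; it exists because `d > 0`.
  · obtain ⟨k, rfl⟩ : ∃ k, i = k + 1 := ⟨i - 1, by omega⟩
    refine ⟨u (k + 1), hiP, u k, Or.inr (Subtype.ext ?_)⟩
    push_cast
    rw [hu _ hi, hu k (by omega), pow_succ]
    field_simp

theorem isPruferDomain : IsPruferDomain A := by
  intro P _
  refine ValuationRing.iff_dvd_total.mpr ⟨fun x y => ?_⟩
  obtain ⟨a, s, rfl⟩ := IsLocalization.exists_mk'_eq P.primeCompl x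
  obtain ⟨b, t, rfl⟩ := IsLocalization.exists_mk'_eq P.primeCompl y
  have key : ∀ (a b r : A) (s t : P.primeCompl) (u : A), u ∉ P → u * b = r * a →
      IsLocalization.mk' (Localization.AtPrime P) a s ∣ IsLocalization.mk' _ b t := by
    intro a b r s t u hu h
    refine ⟨IsLocalization.mk' _ (r * s) ((⟨u, hu⟩ : P.primeCompl) * t), ?_⟩
    rw [← IsLocalization.mk'_mul, IsLocalization.mk'_eq_iff_eq]
    congr 1
    push_cast
    linear_combination (s * t : A) * h
  obtain ⟨u, hu, r, h | h⟩ := hA.exists_notMem_mul_eq P a b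
  · exact Or.inl (key a b r s t u hu h)
  · exact Or.inr (key b a r t s u hu h)

/-- This is `(1, t)^d = (c)` for `t = b / a`, multiplied by `a^d`: the generator is `a^d * c`, a
combination of the products `a^(d - i) * b^i`. -/
theorem exists_span_pair_pow (a b : A) :
    ∃ n, 0 < n ∧ ∃ c : A, (Ideal.span {a} ⊔ Ideal.span {b}) ^ n = Ideal.span {c} := by
  by_cases ha : a = 0
  · exact ⟨1, one_pos, b, by simp [ha]⟩
  have ha' : (a : F) ≠ 0 := fun h => ha (Subtype.ext h)
  obtain ⟨d, hd, c, hc, hmem, e, he⟩ := hA (b / a)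
  have hg : ((∑ i ∈ Finset.range (d + 1), e i * (a ^ (d - i) * b ^ i) : A) : F) = a ^ d * c := by
    push_cast
    rw [← he, Finset.mul_sum]
    refine Finset.sum_congr rfl fun i hi => ?_
    obtain ⟨k, rfl⟩ := Nat.exists_eq_add_of_le (Nat.lt_succ_iff.mp (Finset.mem_range.mp hi))
    rw [Nat.add_sub_cancel_left, pow_add, div_pow]
    field_simp
  refine ⟨d, hd, _, le_antisymm ?_ ((Ideal.span_singleton_le_iff_mem _).mpr
    (Ideal.sum_mem (t := Finset.range (d + 1)) (f := fun i => e i * (a ^ (d - i) * b ^ i)) _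
      fun i hi => Ideal.mul_mem_left _ _ ?_))⟩
  -- Binomial expansion in the semiring of ideals; the binomial coefficients only shrink the terms.
  -- Each `a^i * b^(d - i)` equals `a^d * c` times `t^(d - i) / c`.
  · rw [← Ideal.add_eq_sup, add_pow, Ideal.sum_eq_sup]
    refine Finset.sup_le fun i hi => Ideal.mul_le_left.trans ?_
    have hi' := Nat.lt_succ_iff.mp (Finset.mem_range.mp hi)
    rw [Ideal.span_singleton_pow, Ideal.span_singleton_pow, Ideal.span_singleton_mul_span_singleton,
      Ideal.span_singleton_le_iff_mem, Ideal.mem_span_singleton]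
    refine ⟨⟨_, hmem (d - i) (Nat.sub_le _ _)⟩, Subtype.ext ?_⟩
    refine Eq.trans ?_ (congrArg (· * ((b / a : F) ^ (d - i) / c)) hg.symm)
    push_cast
    obtain ⟨k, rfl⟩ := Nat.exists_eq_add_of_le hi'
    rw [Nat.add_sub_cancel_left, pow_add, div_pow]
    field_simp
  · obtain ⟨k, rfl⟩ := Nat.exists_eq_add_of_le (Nat.lt_succ_iff.mp (Finset.mem_range.mp hi))
    rw [Nat.add_sub_cancel_left, add_comm i k, pow_add]
    exact Ideal.mul_mem_mul
      (Ideal.pow_mem_pow (Ideal.mem_sup_left (Ideal.mem_span_singleton_self a)) _)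
      (Ideal.pow_mem_pow (Ideal.mem_sup_right (Ideal.mem_span_singleton_self b)) _)

end HasPrincipalPowers

/-- In a Prüfer domain, forming powers of ideals is additive. -/
theorem IsPruferDomain.sup_pow {A : Type u} [CommRing A] [IsDomain A] (hA : IsPruferDomain A)
    (I J : Ideal A) (n : ℕ) : (I ⊔ J) ^ n = I ^ n ⊔ J ^ n := by
  -- Over each local ring, a valuation ring, one of the two ideals contains the other and absorbs it
  -- on both sides.
  refine Ideal.eq_of_localization_maximal fun P _ => ?_
  simp only [Ideal.map_pow, Ideal.map_sup]
  rcases (ValuationRing.iff_ideal_total.mp (hA P)).total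
    (I.map (algebraMap A (Localization.AtPrime P)))
    (J.map (algebraMap A (Localization.AtPrime P))) with h | h
  · rw [sup_eq_right.mpr h, sup_eq_right.mpr (Ideal.pow_right_mono h n)]
  · rw [sup_eq_left.mpr h, sup_eq_left.mpr (Ideal.pow_right_mono h n)]

namespace HasPrincipalPowers

variable {F : Type u} [Field F] {A : Subring F} (hA : HasPrincipalPowers A)

include hA

/-- Induction on generators: if `I^n = (a)` and `J^m = (b)`, then `(I + J)^(n * m) = (a^m, b^n)`,
and the case of two generators applies. -/
theorem exists_pow_eq_span (I : Ideal A) (hI : I.FG) :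
    ∃ n, 0 < n ∧ ∃ c : A, I ^ n = Ideal.span {c} := by
  induction I, hI using Submodule.fg_induction with
  | singleton x => exact ⟨1, one_pos, x, pow_one _⟩
  | sup I J _ _ hI hJ =>
    obtain ⟨n, hn, a, ha⟩ := hI
    obtain ⟨m, hm, b, hb⟩ := hJ
    obtain ⟨k, hk, c, hc⟩ := hA.exists_span_pair_pow (a ^ m) (b ^ n)
    refine ⟨n * m * k, by positivity, c, ?_⟩
    rw [pow_mul, hA.isPruferDomain.sup_pow, pow_mul, ha, mul_comm n m, pow_mul, hb,
      Ideal.span_singleton_pow, Ideal.span_singleton_pow, hc]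

open nonZeroDivisors in
-- An invertible fractional ideal is finitely generated and differs from its integral numerator by a
-- scalar, so a principal power of the numerator suffices.
theorem isMulTorsion_classGroup : IsMulTorsion (ClassGroup A) := by
  intro x
  refine ClassGroup.induction (FractionRing A) (fun I => ?_) x
  have hfg : (I.1.num).FG := by
    have : Module.Finite A (I.1 : Submodule A (FractionRing A)) :=
      Module.Finite.iff_fg.mpr (FractionalIdeal.fg_unit I)
    have := Module.Finite.equiv
      (FractionalIdeal.equivNum (I := I.1) (nonZeroDivisors.coe_ne_zero I.1.den))
    exact Module.Finite.iff_fg.mp this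
  obtain ⟨n, hn, c, hc⟩ := hA.exists_pow_eq_span _ hfg
  refine isOfFinOrder_iff_pow_eq_one.mpr ⟨n, hn, ?_⟩
  rw [← map_pow, ClassGroup.mk_eq_one_iff]
  have h1 : (I.1) ^ n = FractionalIdeal.spanSingleton A⁰
      ((algebraMap A (FractionRing A) c) / (algebraMap A (FractionRing A) I.1.den) ^ n) := by
    have h0 : algebraMap A (FractionRing A) I.1.den ≠ 0 := by
      simp
    have h2 := congrArg (· ^ n) (FractionalIdeal.den_mul_self_eq_num' A⁰ (FractionRing A) I.1)
    simp only [mul_pow, FractionalIdeal.spanSingleton_pow, ← FractionalIdeal.coeIdeal_pow, hc,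
      FractionalIdeal.coeIdeal_span_singleton] at h2
    rw [div_eq_inv_mul, ← FractionalIdeal.spanSingleton_mul_spanSingleton, ← h2, ← mul_assoc,
      FractionalIdeal.spanSingleton_mul_spanSingleton, inv_mul_cancel₀ (pow_ne_zero _ h0),
      FractionalIdeal.spanSingleton_one, one_mul]
  rw [Units.val_pow_eq_pow_val, h1, FractionalIdeal.coe_spanSingleton]
  exact ⟨⟨_, rfl⟩⟩

theorem isMulTorsion_pic : IsMulTorsion (CommRing.Pic A) :=
  hA.isMulTorsion_classGroup.of_surjective (f := (ClassGroup.equivPic A).toMonoidHom)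
    (ClassGroup.equivPic A).surjective

end HasPrincipalPowers

end ZR

/-! ### The points `[1 : t]` of the projective line and evaluation of homogeneous fractions there -/

namespace ZR

attribute [local instance] MvPolynomial.gradedAlgebra

theorem aeval_mul_of_isHomogeneous {R S σ : Type*} [CommSemiring R] [CommSemiring S] [Algebra R S]
    [Fintype σ] {f : MvPolynomial σ R} {d : ℕ} (hf : f.IsHomogeneous d) (r : S) (x : σ → S) :
    MvPolynomial.aeval (fun i => r * x i) f = r ^ d * MvPolynomial.aeval x f := by
  simp only [MvPolynomial.aeval_def, MvPolynomial.eval₂_eq', Finset.mul_sum]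
  refine Finset.sum_congr rfl fun m hm => ?_
  have hd : ∑ i, m i = d := by
    rw [hf.degree_eq_sum_deg_support hm]
    exact (Finset.sum_subset (Finset.subset_univ _) fun i _ hi => by simpa using hi).symm
  simp only [mul_pow, Finset.prod_mul_distrib, Finset.prod_pow_eq_pow_sum, hd]
  ring

theorem isUnit_mk_of_num_mem {A : Type*} [CommRing A] {σ : Type*} [SetLike σ A]
    [AddSubgroupClass σ A] {𝒜 : ℕ → σ} [GradedRing 𝒜] {S : Submonoid A}
    (p : HomogeneousLocalization.NumDenSameDeg 𝒜 S) (h : p.num.1 ∈ S) :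
    IsUnit (HomogeneousLocalization.mk p) := by
  refine IsUnit.of_mul_eq_one (HomogeneousLocalization.mk ⟨p.deg, p.den, p.num, h⟩) ?_
  refine HomogeneousLocalization.val_injective _ ?_
  rw [HomogeneousLocalization.val_mul, HomogeneousLocalization.val_one,
    HomogeneousLocalization.val_mk, HomogeneousLocalization.val_mk, Localization.mk_mul,
    Localization.mk_eq_mk', IsLocalization.mk'_eq_iff_eq_mul, one_mul]
  exact congrArg _ (mul_comm _ _)

section point

variable {F : Type u} [Field F] {D : Subring F} (t : F)

/-- Evaluation of polynomials at `(1, t)`. -/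
noncomputable def evalAt (D : Subring F) : MvPolynomial (Fin 2) D →ₐ[D] F :=
  MvPolynomial.aeval ![1, t]

theorem exists_evalAt_eq_sum {f : MvPolynomial (Fin 2) D} {d : ℕ} (hf : f.IsHomogeneous d) :
    ∃ e : ℕ → D, ∑ i ∈ Finset.range (d + 1), (e i : F) * t ^ i = evalAt t D f := by
  -- Setting the first variable to `1` merges monomials with the same exponent in the second;
  -- homogeneity bounds that exponent by `d`.
  refine ⟨fun i => ∑ m ∈ f.support with m 1 = i, f.coeff m, ?_⟩
  have h : evalAt t D f = ∑ m ∈ f.support, (algebraMap D F (f.coeff m)) * t ^ (m 1) := by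
    rw [evalAt, MvPolynomial.aeval_def, MvPolynomial.eval₂_eq']
    refine Finset.sum_congr rfl fun m _ => ?_
    simp [Fin.prod_univ_two]
  rw [h, ← Finset.sum_fiberwise_of_maps_to (g := fun m : Fin 2 →₀ ℕ => m 1)
    (t := Finset.range (d + 1))]
  · refine Finset.sum_congr rfl fun i _ => ?_
    push_cast
    rw [Finset.sum_mul]
    refine Finset.sum_congr rfl fun m hm => ?_
    rw [(Finset.mem_filter.mp hm).2]
    rfl
  · intro m hm
    rw [Finset.mem_range, Nat.lt_succ_iff, hf.degree_eq_sum_deg_support hm]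
    by_cases h1 : m 1 = 0
    · simp [h1]
    · exact Finset.single_le_sum (f := fun i => m i) (fun _ _ => Nat.zero_le _)
        (Finsupp.mem_support_iff.mpr h1)

open Classical in
/-- The one of `1` and `t` that has the smaller value at `V`. -/
noncomputable def scale (V : ValuationSubring F) : F := if t ∈ V then 1 else t

theorem scale_ne_zero (V : ValuationSubring F) : scale t V ≠ 0 := by
  unfold scale
  split_ifs with h
  · exact one_ne_zero
  · rintro rfl
    exact h (zero_mem _)

theorem inv_scale_mem (V : ValuationSubring F) : (scale t V)⁻¹ ∈ V := by
  unfold scale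
  split_ifs with h
  · simp
  · exact (V.mem_or_inv_mem t).resolve_left h

theorem inv_scale_mul_mem (V : ValuationSubring F) : (scale t V)⁻¹ * t ∈ V := by
  unfold scale
  split_ifs with h
  · simpa using h
  · rw [inv_mul_cancel₀ fun h0 : t = 0 => h (h0 ▸ zero_mem _)]
    exact one_mem _

theorem scale_pow_eq (V : ValuationSubring F) (d : ℕ) : ∃ i ≤ d, scale t V ^ d = t ^ i := by
  unfold scale
  split_ifs
  · exact ⟨0, d.zero_le, by simp⟩
  · exact ⟨d, le_rfl, rfl⟩

/-- The homogeneous coordinates `(1, t)`, scaled to be unimodular over `V`. -/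
noncomputable def coord (V : ValuationSubring F) : Fin 2 → V :=
  ![⟨_, inv_scale_mem t V⟩, ⟨_, inv_scale_mul_mem t V⟩]

/-- Evaluation of polynomials over `D` at the unimodular coordinates over `V`. -/
noncomputable def evalCoord (V : Space D) : MvPolynomial (Fin 2) D →+* V.1 :=
  MvPolynomial.eval₂Hom (Subring.inclusion V.2) (coord t V.1)

theorem coe_evalCoord (V : Space D) {f : MvPolynomial (Fin 2) D} {d : ℕ} (hf : f.IsHomogeneous d) :
    (evalCoord t V f : F) = evalAt t D f / scale t V.1 ^ d := by
  have h1 : (evalCoord t V f : F) =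
      MvPolynomial.aeval (fun i => (scale t V.1)⁻¹ * ![1, t] i) f := by
    have := MvPolynomial.eval₂_comp_left V.1.subtype (Subring.inclusion V.2) (coord t V.1) f
    refine this.trans ?_
    rw [MvPolynomial.aeval_def]
    congr 1
    funext i
    fin_cases i <;> simp [coord]
  rw [h1, aeval_mul_of_isHomogeneous hf, inv_pow, div_eq_inv_mul]
  rfl

theorem notMem_maximalIdeal_iff (V : ValuationSubring F) (y : V) :
    y ∉ IsLocalRing.maximalIdeal V ↔ (y : F) ≠ 0 ∧ (y : F)⁻¹ ∈ V := by
  rw [← V.coe_mem_nonunits_iff, V.mem_nonunits_iff_or, not_or, not_not]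

/-- With `s = scale t V` and `c = f(1, t)`, the value of `f` at the scaled coordinates is `c / s^d`,
a unit iff `c ≠ 0` and `s^d / c ∈ V`. Multiplying `s^d / c` by `(t / s)^i * (1 / s)^(d - i)` gives
`t^i / c`; conversely, `s^d` is itself some `t^i`. The resulting condition no longer involves `s`,
which depends on `V`. -/
theorem evalCoord_notMem_iff (V : Space D) {f : MvPolynomial (Fin 2) D} {d : ℕ}
    (hf : f.IsHomogeneous d) :
    evalCoord t V f ∉ IsLocalRing.maximalIdeal V.1 ↔
      evalAt t D f ≠ 0 ∧ ∀ i ≤ d, t ^ i / evalAt t D f ∈ V.1 := by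
  have hs := scale_ne_zero t V.1
  rw [notMem_maximalIdeal_iff, coe_evalCoord t V hf, inv_div]
  constructor
  · rintro ⟨h0, hmem⟩
    refine ⟨fun h => h0 (by rw [h, zero_div]), fun i hi => ?_⟩
    obtain ⟨k, rfl⟩ := Nat.exists_eq_add_of_le hi
    have := mul_mem hmem (mul_mem (pow_mem (inv_scale_mul_mem t V.1) i)
      (pow_mem (inv_scale_mem t V.1) k))
    convert this using 1
    rw [mul_pow, pow_add, inv_pow, inv_pow]
    field_simp
  · rintro ⟨h0, hmem⟩
    refine ⟨div_ne_zero h0 (pow_ne_zero _ hs), ?_⟩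
    obtain ⟨i, hi, h⟩ := scale_pow_eq t V.1 d
    rw [h]
    exact hmem i hi

/-- The point `[1 : t]` of the projective line over the valuation ring `V`, or rather the image in
`ℙ¹_D` of its closed point. -/
noncomputable def point (V : Space D) :
    ProjectiveSpectrum (MvPolynomial.homogeneousSubmodule (Fin 2) D) where
  -- The preimage of the maximal ideal need not be homogeneous; its core is prime and has the same
  -- homogeneous elements.
  asHomogeneousIdeal := Ideal.homogeneousCore _
    ((IsLocalRing.maximalIdeal V.1).comap (evalCoord t V))
  isPrime := Ideal.IsPrime.homogeneousCore inferInstance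
  not_irrelevant_le h := by
    have hX : ∀ i : Fin 2, evalCoord t V (MvPolynomial.X i) ∈ IsLocalRing.maximalIdeal V.1 := by
      intro i
      refine Ideal.toIdeal_homogeneousCore_le (MvPolynomial.homogeneousSubmodule (Fin 2) D)
        ((IsLocalRing.maximalIdeal V.1).comap (evalCoord t V)) (h ?_)
      rw [HomogeneousIdeal.mem_irrelevant_iff, GradedRing.proj_apply,
        DirectSum.decompose_of_mem_ne _
          ((MvPolynomial.mem_homogeneousSubmodule 1 _).mpr (MvPolynomial.isHomogeneous_X D i))
          one_ne_zero]
    -- One of the scaled coordinates is `1`, hence a unit in `V`.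
    have hnot : ∃ i : Fin 2,
        evalCoord t V (MvPolynomial.X i) ∉ IsLocalRing.maximalIdeal V.1 := by
      simp only [notMem_maximalIdeal_iff,
        coe_evalCoord t V (MvPolynomial.isHomogeneous_X D _), inv_div]
      by_cases ht : t ∈ V.1
      · exact ⟨0, by simp [evalAt, scale, ht]⟩
      · have : t ≠ 0 := fun h => ht (h ▸ zero_mem _)
        exact ⟨1, by simp [evalAt, scale, ht, this]⟩
    exact hnot.elim fun i hi => hi (hX i)

theorem notMem_point_iff (V : Space D) {f : MvPolynomial (Fin 2) D} {d : ℕ}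
    (hf : f.IsHomogeneous d) :
    f ∉ (point t V).asHomogeneousIdeal ↔
      evalAt t D f ≠ 0 ∧ ∀ i ≤ d, t ^ i / evalAt t D f ∈ V.1 := by
  rw [← evalCoord_notMem_iff t V hf, not_iff_not]
  exact ⟨fun h => Ideal.toIdeal_homogeneousCore_le (MvPolynomial.homogeneousSubmodule (Fin 2) D)
      ((IsLocalRing.maximalIdeal V.1).comap (evalCoord t V)) h,
    fun h => Ideal.mem_homogeneousCore_of_homogeneous_of_mem ⟨d, hf⟩ h⟩

/-- A basic open set is the union of those of the homogeneous components of `f`. For a homogeneous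
component, the preimage is cut out by a condition independent of `V` and finitely many memberships
`t^i / c ∈ V`. -/
theorem continuous_point : Continuous (point t : Space D → _) := by
  rw [(ProjectiveSpectrum.isTopologicalBasis_basic_opens _).continuous_iff]
  rintro _ ⟨f, rfl⟩
  beta_reduce
  rw [ProjectiveSpectrum.basicOpen_eq_union_of_projection]
  simp only [Opens.coe_iSup, Set.preimage_iUnion]
  refine isOpen_iUnion fun d => ?_
  generalize hg : GradedRing.proj (MvPolynomial.homogeneousSubmodule (Fin 2) D) d f = g
  have hgd : g.IsHomogeneous d := by
    rw [← hg]
    exact SetLike.coe_mem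
      (DirectSum.decompose (MvPolynomial.homogeneousSubmodule (Fin 2) D) f d)
  have h : {V : Space D | g ∉ (point t V).asHomogeneousIdeal} =
      {_V : Space D | evalAt t D g ≠ 0} ∩
        ⋂ i ∈ Set.Iic d, {V : Space D | t ^ i / evalAt t D g ∈ V.1} := by
    ext V
    rw [Set.mem_ofPred_eq, notMem_point_iff t V hgd]
    simp
  change IsOpen {V : Space D | g ∉ (point t V).asHomogeneousIdeal}
  rw [h]
  exact isOpen_const.inter ((Set.finite_Iic d).isOpen_biInter fun i _ => isOpen_setOf_mem D _)

/-- Evaluation at `(1, t)` of homogeneous fractions. -/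
noncomputable def evalFrac (S : Submonoid (MvPolynomial (Fin 2) D))
    (hS : ∀ f ∈ S, ∀ d, f.IsHomogeneous d → evalAt t D f ≠ 0) :
    HomogeneousLocalization (MvPolynomial.homogeneousSubmodule (Fin 2) D) S →+* F where
  toFun x := Quotient.liftOn' x (fun p => evalAt t D p.num.1 / evalAt t D p.den.1) fun p q h => by
    have hp := hS _ p.den_mem _ p.den.2
    have hq := hS _ q.den_mem _ q.den.2
    have h' : Localization.mk p.num.1 ⟨p.den.1, p.den_mem⟩ =
      Localization.mk q.num.1 ⟨q.den.1, q.den_mem⟩ := h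
    rw [Localization.mk_eq_mk_iff, Localization.r_iff_exists] at h'
    obtain ⟨c, hc⟩ := h'
    -- `c` need not be homogeneous, so `hS` does not apply to it in general. But `0` is homogeneous
    -- and vanishes at `(1, t)`, so `hS` excludes `c = 0`, which is enough to cancel in a domain.
    have hc0 : c.1 ≠ 0 := fun h0 =>
      hS c.1 c.2 0 (by rw [h0]; exact MvPolynomial.isHomogeneous_zero _ _ _) (by simp [h0])
    have h2 := congrArg (evalAt t D) (mul_left_cancel₀ hc0 hc)
    simp only [map_mul] at h2
    change _ / _ = _ / _
    rw [div_eq_div_iff hp hq]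
    linear_combination h2
  map_one' := by
    change evalAt t D 1 / evalAt t D 1 = 1
    simp
  map_zero' := by
    change evalAt t D 0 / evalAt t D 1 = 0
    simp
  map_mul' x y := by
    induction x using Quotient.inductionOn' with | h p => ?_
    induction y using Quotient.inductionOn' with | h q => ?_
    change evalAt t D (p.num.1 * q.num.1) / evalAt t D (p.den.1 * q.den.1) =
      evalAt t D p.num.1 / evalAt t D p.den.1 * (evalAt t D q.num.1 / evalAt t D q.den.1)
    rw [map_mul, map_mul, div_mul_div_comm]
  map_add' x y := by
    induction x using Quotient.inductionOn' with | h p => ?_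
    induction y using Quotient.inductionOn' with | h q => ?_
    have hp := hS _ p.den_mem _ p.den.2
    have hq := hS _ q.den_mem _ q.den.2
    change evalAt t D (p.den.1 * q.num.1 + q.den.1 * p.num.1) / evalAt t D (p.den.1 * q.den.1) =
      evalAt t D p.num.1 / evalAt t D p.den.1 + evalAt t D q.num.1 / evalAt t D q.den.1
    rw [map_mul, map_add, map_mul, map_mul, div_add_div _ _ hp hq]
    ring

/-- The value at `(1, t)` of germs of functions at the point `[1 : t]` over `V`. -/
noncomputable def pointValue (V : Space D) :
    HomogeneousLocalization.AtPrime (MvPolynomial.homogeneousSubmodule (Fin 2) D)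
      (point t V).asHomogeneousIdeal.toIdeal →+* F :=
  evalFrac t _ fun _ hf _ hd => ((notMem_point_iff t V hd).mp hf).1

theorem pointValue_mk (V : Space D) (p) :
    pointValue t V (.mk p) = evalAt t D p.num.1 / evalAt t D p.den.1 := rfl

/-- Numerator and denominator have the same degree, so the powers of `scale t V` cancel: the value
is a quotient of elements of `V` with a unit as denominator. -/
theorem pointValue_mem (V : Space D) (x) : pointValue t V x ∈ V.1 := by
  obtain ⟨p, rfl⟩ := HomogeneousLocalization.mk_surjective x
  have h := evalCoord_notMem_iff t V p.den.2
  have hden := (h.trans (notMem_point_iff t V p.den.2).symm).mpr p.den_mem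
  rw [notMem_maximalIdeal_iff] at hden
  have := mul_mem (evalCoord t V p.num.1).2 hden.2
  rw [coe_evalCoord t V p.num.2, coe_evalCoord t V p.den.2] at this
  rw [pointValue_mk]
  convert this using 1
  have hs := scale_ne_zero t V.1
  have hd := ((notMem_point_iff t V p.den.2).mp p.den_mem).1
  field_simp

/-- This is what makes the map on stalks local. Multiplying `t^i / den` by `den / num ∈ V` gives
`t^i / num ∈ V`, so the numerator also lies outside the prime and the fraction can be inverted. -/
theorem isUnit_of_pointValue (V : Space D) (x) (h0 : pointValue t V x ≠ 0)
    (hinv : (pointValue t V x)⁻¹ ∈ V.1) : IsUnit x := by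
  obtain ⟨p, rfl⟩ := HomogeneousLocalization.mk_surjective x
  rw [pointValue_mk] at h0 hinv
  rw [inv_div] at hinv
  have hd := (notMem_point_iff t V p.den.2).mp p.den_mem
  have hn0 : evalAt t D p.num.1 ≠ 0 := (div_ne_zero_iff.mp h0).1
  have hnum : p.num.1 ∉ (point t V).asHomogeneousIdeal := by
    refine (notMem_point_iff t V p.num.2).mpr ⟨hn0, fun i hi => ?_⟩
    have := mul_mem (hd.2 i hi) hinv
    rwa [div_mul_div_cancel₀ hd.1] at this
  exact isUnit_mk_of_num_mem p hnum

end point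

end ZR

/-! ### The morphism from `Z` to the projective line defined by `[1 : t]` -/

namespace ZR

attribute [local instance] MvPolynomial.gradedAlgebra

section morphism

variable {F : Type u} [Field F] {D : Subring F} (Z : Set (Space D))

theorem ne_zero_and_inv_mem_of_isUnit_germ (V : TopCat.of Z) (U : Opens (TopCat.of Z)) (hV : V ∈ U)
    (s : sections Z U) (h : IsUnit ((presheaf Z).germ U V hV s)) :
    s.1 ⟨V, hV⟩ ≠ 0 ∧ (s.1 ⟨V, hV⟩)⁻¹ ∈ V.1.1 := by
  obtain ⟨y, hy⟩ := h.exists_right_inv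
  obtain ⟨W, hVW, r, rfl⟩ := (presheaf Z).exists_germ_eq y
  change sections Z W at r
  let U' : Opens (TopCat.of Z) := U ⊓ W
  have hU' : V ∈ U' := ⟨hV, hVW⟩
  have e1 : (presheaf Z).germ U V hV s =
      (presheaf Z).germ U' V hU' (restrict Z inf_le_left s) :=
    ((presheaf Z).germ_res_apply (homOfLE inf_le_left) V hU' s).symm
  have e2 : (presheaf Z).germ W V hVW r =
      (presheaf Z).germ U' V hU' (restrict Z inf_le_right r) :=
    ((presheaf Z).germ_res_apply (homOfLE inf_le_right) V hU' r).symm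
  rw [e1, e2] at hy
  have hy' : (presheaf Z).germ U' V hU'
      (restrict Z inf_le_left s * restrict Z inf_le_right r : sections Z U') =
      (presheaf Z).germ U' V hU' (1 : sections Z U') :=
    ((map_mul ((presheaf Z).germ U' V hU').hom _ _).trans hy).trans
      (map_one ((presheaf Z).germ U' V hU').hom).symm
  have hsr : s.1 ⟨V, hV⟩ * r.1 ⟨V, hVW⟩ = 1 := eq_of_germ_eq Z V U' U' hU' hU' _ _ hy'
  obtain ⟨a, ha⟩ := r.2
  refine ⟨left_ne_zero_of_mul_eq_one hsr, ?_⟩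
  rw [inv_eq_of_mul_eq_one_right hsr, (ha ⟨V, hVW⟩).2]
  exact (ha ⟨V, hVW⟩).1

variable (t : F)

/-- Sections over `Z` are constant functions, so a pulled back section must have one value. Near the
image of `V` it is a single fraction `a / b`, and that neighbourhood also contains the image of the
generic point, since `F` lies in every nonempty open set. -/
theorem pointValue_section_eq
    {U : Opens (ProjectiveSpectrum.top (MvPolynomial.homogeneousSubmodule (Fin 2) D))}
    (s : (ProjectiveSpectrum.Proj.structureSheaf
      (MvPolynomial.homogeneousSubmodule (Fin 2) D)).1.obj (op U))
    (V : Space D) (hV : point t V ∈ U) (hU : point t (Space.generic D) ∈ U) :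
    pointValue t V (s.1 ⟨_, hV⟩) = pointValue t (Space.generic D) (s.1 ⟨_, hU⟩) := by
  obtain ⟨W, hVW, i, d, a, b, hb, h⟩ := s.2 ⟨_, hV⟩
  have hW : point t (Space.generic D) ∈ W :=
    generic_mem (W.2.preimage (continuous_point t)) (V := V) hVW
  have h1 := h ⟨_, hVW⟩
  have h2 := h ⟨_, hW⟩
  have e1 := (congrArg (pointValue t V) h1).trans (pointValue_mk t V _)
  have e2 := (congrArg (pointValue t (Space.generic D)) h2).trans (pointValue_mk t _ _)
  exact e1.trans e2.symm

/-- The continuous map `V ↦ [1 : t]` from `Z` to the projective line. -/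
noncomputable def pointBase : TopCat.of Z ⟶
    ProjectiveSpectrum.top (MvPolynomial.homogeneousSubmodule (Fin 2) D) :=
  TopCat.ofHom ⟨fun V => point t V.1, (continuous_point t).comp continuous_subtype_val⟩

/-- Pullback of functions along `V ↦ [1 : t]`. -/
noncomputable def pullbackSection (hZ : Space.generic D ∈ Z)
    (U : Opens (ProjectiveSpectrum.top (MvPolynomial.homogeneousSubmodule (Fin 2) D))) :
    (ProjectiveSpectrum.Proj.structureSheaf
      (MvPolynomial.homogeneousSubmodule (Fin 2) D)).1.obj (op U) →+*
      sections Z ((Opens.map (pointBase Z t)).obj U) where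
  toFun s := ⟨fun V => pointValue t V.1.1 (s.1 ⟨point t V.1.1, V.2⟩), by
    by_cases h : Nonempty ((Opens.map (pointBase Z t)).obj U : Opens (TopCat.of Z))
    · obtain ⟨V₀⟩ := h
      have hg : point t (Space.generic D) ∈ U :=
        generic_mem_opens hZ ((Opens.map (pointBase Z t)).obj U) V₀.2
      refine ⟨pointValue t (Space.generic D) (s.1 ⟨_, hg⟩), fun V => ?_⟩
      have h := pointValue_section_eq t s V.1.1 V.2 hg
      exact ⟨h ▸ pointValue_mem t V.1.1 _, h⟩
    · exact ⟨0, fun V => absurd ⟨V⟩ h⟩⟩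
  map_one' := Subtype.ext (funext fun V => map_one (pointValue t V.1.1))
  map_zero' := Subtype.ext (funext fun V => map_zero (pointValue t V.1.1))
  map_mul' _ _ := Subtype.ext (funext fun V => map_mul (pointValue t V.1.1) _ _)
  map_add' _ _ := Subtype.ext (funext fun V => map_add (pointValue t V.1.1) _ _)

/-- The morphism `V ↦ [1 : t]` from `Z` to the projective line, as a morphism of presheafed
spaces. -/
noncomputable def pointPresheafedHom (hZ : Space.generic D ∈ Z) :
    (toLRS Z hZ).toPresheafedSpace.Hom (P1 D).toLocallyRingedSpace.toPresheafedSpace where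
  base := pointBase Z t
  c :=
    { app := fun U => CommRingCat.ofHom
        (R := (ProjectiveSpectrum.Proj.structureSheaf
          (MvPolynomial.homogeneousSubmodule (Fin 2) D)).1.obj (op U.unop))
        (S := sections Z ((Opens.map (pointBase Z t)).obj U.unop))
        (pullbackSection Z t hZ U.unop)
      naturality := fun _ _ _ => rfl }

/-- If the pulled back germ is a unit, its value is a unit of `V`. By `isUnit_of_pointValue` the
original germ is then a unit in the homogeneous localization, which is the stalk of `ℙ¹_D`. -/
theorem isLocalHom_stalkMap_pointPresheafedHom (hZ : Space.generic D ∈ Z) (V : TopCat.of Z) :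
    IsLocalHom ((pointPresheafedHom Z t hZ).stalkMap V).hom := by
  constructor
  intro x hx
  obtain ⟨U, hU, s, rfl⟩ := (P1 D).toLocallyRingedSpace.presheaf.exists_germ_eq x
  have e := PresheafedSpace.stalkMap_germ_apply (pointPresheafedHom Z t hZ) U V hU s
  have hx' := e ▸ hx
  have h := ne_zero_and_inv_mem_of_isUnit_germ Z V _ hU (pullbackSection Z t hZ U s) hx'
  have hu := isUnit_of_pointValue t V.1 _ h.1 h.2
  have h3 := Proj.stalkIso'_germ (MvPolynomial.homogeneousSubmodule (Fin 2) D) U (point t V.1) hU s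
  rw [← h3] at hu
  exact (MulEquiv.isUnit_map _).mp hu

/-- The morphism `V ↦ [1 : t]` from `Z` to the projective line. -/
noncomputable def pointHom (hZ : Space.generic D ∈ Z) :
    toLRS Z hZ ⟶ (P1 D).toLocallyRingedSpace where
  toHom := pointPresheafedHom Z t hZ
  prop := isLocalHom_stalkMap_pointPresheafedHom Z t hZ

end morphism

end ZR

/-! ### Compatibility with the structure morphisms, and the conclusion -/

namespace ZR

attribute [local instance] MvPolynomial.gradedAlgebra

/-- By the adjunction between global sections and `Spec`, a morphism to an affine scheme is
determined on global sections. Compatibility over `D` thus becomes a computation with elements of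
`D`. -/
theorem hom_ext_toSpec {X : LocallyRingedSpace.{u}} {R : CommRingCat.{u}}
    {f g : X ⟶ Spec.toLocallyRingedSpace.obj (op R)}
    (h : (Scheme.ΓSpecIso R).inv ≫ f.c.app (op ⊤) =
      (Scheme.ΓSpecIso R).inv ≫ g.c.app (op ⊤)) : f = g := by
  refine (ΓSpec.locallyRingedSpaceAdjunction.homEquiv X (op R)).symm.injective ?_
  rw [Adjunction.homEquiv_counit, Adjunction.homEquiv_counit]
  exact Quiver.Hom.unop_inj h

/-- `Proj.toSpecZero` passes through the chart where `1` is invertible, which is all of `Proj`; this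
computes the resulting identifications on global sections. -/
theorem topIso_comp_appTop_isoOfEq_topIso (X : Scheme.{u}) {U : X.Opens} (h : U = ⊤) :
    U.topIso.inv ≫ (X.isoOfEq h).inv.appTop ≫ X.topIso.inv.appTop =
      X.presheaf.map (eqToHom h.symm).op := by
  subst h
  have h1 := congrArg Scheme.Hom.appTop X.toIso_inv_ι
  rw [Scheme.Hom.comp_appTop, Scheme.Opens.ι_appTop] at h1
  rw [Scheme.isoOfEq_rfl]
  refine Eq.trans (Eq.trans ?_ h1) ?_
  · rfl
  · simp

theorem toSpecZero_appTop {A σ : Type u} [CommRing A] [SetLike σ A] [AddSubgroupClass σ A]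
    (𝒜 : ℕ → σ) [GradedRing 𝒜] :
    (Scheme.ΓSpecIso (CommRingCat.of (𝒜 0))).inv ≫ (Proj.toSpecZero 𝒜).appTop =
      CommRingCat.ofHom (HomogeneousLocalization.fromZeroRingHom 𝒜 _) ≫
        Proj.awayToSection 𝒜 1 ≫
        (Proj 𝒜).presheaf.map (eqToHom (Proj.basicOpen_one 𝒜).symm).op := by
  have h := Proj.basicOpenToSpec_app_top 𝒜 1
  rw [← topIso_comp_appTop_isoOfEq_topIso _ (Proj.basicOpen_one 𝒜), Proj.toSpecZero]
  simp only [Scheme.Hom.comp_appTop, Category.assoc, ← Scheme.ΓSpecIso_inv_naturality_assoc]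
  rw [show (Proj.basicOpenToSpec 𝒜 1).appTop = _ from h]
  simp only [Category.assoc, Iso.inv_hom_id_assoc]

theorem structureMorphism_appTop (D : Type u) [CommRing D] :
    (Scheme.ΓSpecIso (CommRingCat.of D)).inv ≫ (P1.structureMorphism D).appTop =
      CommRingCat.ofHom (algebraMap D (MvPolynomial.homogeneousSubmodule (Fin 2) D 0)) ≫
        CommRingCat.ofHom (HomogeneousLocalization.fromZeroRingHom
          (MvPolynomial.homogeneousSubmodule (Fin 2) D) _) ≫
        Proj.awayToSection (MvPolynomial.homogeneousSubmodule (Fin 2) D) 1 ≫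
        (P1 D).presheaf.map (eqToHom (Proj.basicOpen_one _).symm).op := by
  rw [P1.structureMorphism, Scheme.Hom.comp_appTop, ← Scheme.ΓSpecIso_inv_naturality_assoc,
    toSpecZero_appTop]

theorem structureMorphism_appTop_apply (D : Type u) [CommRing D] (d : D) (x : P1 D) :
    (((Scheme.ΓSpecIso (CommRingCat.of D)).inv ≫ (P1.structureMorphism D).appTop).hom d :
      (ProjectiveSpectrum.Proj.structureSheaf
      (MvPolynomial.homogeneousSubmodule (Fin 2) D)).1.obj (op ⊤)).1 ⟨x, trivial⟩ =
    HomogeneousLocalization.mk ⟨0, ⟨MvPolynomial.C d, MvPolynomial.isHomogeneous_C _ d⟩,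
      ⟨1, MvPolynomial.isHomogeneous_one _ _⟩, one_mem _⟩ := by
  rw [structureMorphism_appTop]
  rfl

variable {F : Type u} [Field F] {D : Subring F} (Z : Set (Space D)) (t : F)

theorem isDMorphism_pointHom (hZ : Space.generic D ∈ Z) : IsDMorphism (pointHom Z t hZ) := by
  refine hom_ext_toSpec (R := CommRingCat.of D) (CommRingCat.hom_ext (RingHom.ext fun d => ?_))
  have h2 : ((Scheme.ΓSpecIso (CommRingCat.of D)).inv ≫
      (structureMorphism Z hZ).c.app (op ⊤)).hom d = constSection Z ⊤ d.1 fun W => W.1.1.2 d.2 :=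
    congrArg (fun f => f.hom d) (structureMorphism_app Z hZ (op ⊤))
  refine Eq.trans (Subtype.ext (funext fun V => ?_)) h2.symm
  -- On `ℙ¹_D` the element `d` becomes the constant fraction `d / 1`, whose value at `(1, t)` is
  -- `d`, as for the inclusion of `D`.
  have h1 := congrArg (pointValue t V.1.1) (structureMorphism_appTop_apply D d (point t V.1.1))
  rw [pointValue_mk] at h1
  refine Eq.trans h1 ?_
  change evalAt t D (MvPolynomial.C d) / evalAt t D 1 = d
  rw [map_one, div_one]
  exact MvPolynomial.aeval_C _ _

theorem hasPrincipalPowers_holomorphyRing (hZ : Space.generic D ∈ Z)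
    (h : ∀ φ : toLRS Z hZ ⟶ (P1 D).toLocallyRingedSpace, IsDMorphism φ →
      ∃ (d : ℕ) (f : MvPolynomial (Fin 2) D), 0 < d ∧ f.IsHomogeneous d ∧
        Set.range φ.base ⊆ (P1.basicOpen f : Set (P1 D))) :
    HasPrincipalPowers (holomorphyRing Z) := by
  intro t
  obtain ⟨d, f, hd, hf, hrange⟩ := h _ (isDMorphism_pointHom Z t hZ)
  have key : ∀ V ∈ Z, evalAt t D f ≠ 0 ∧ ∀ i ≤ d, t ^ i / evalAt t D f ∈ V.1 := fun V hV =>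
    (notMem_point_iff t V hf).mp (hrange ⟨⟨V, hV⟩, rfl⟩)
  obtain ⟨e, he⟩ := exists_evalAt_eq_sum t hf
  have hD : ∀ a : D, (a : F) ∈ holomorphyRing Z := fun a =>
    Subring.mem_iInf.mpr fun V => Subring.mem_iInf.mpr fun _ => V.2 a.2
  -- The generator is `c = f(1, t)`. The point `F ∈ Z` guarantees `c ≠ 0`, even if no other point
  -- lies in `Z`.
  exact ⟨d, hd, evalAt t D f, (key _ hZ).1,
    fun i hi => Subring.mem_iInf.mpr fun V => Subring.mem_iInf.mpr fun hV => (key V hV).2 i hi,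
    fun i => ⟨e i, hD (e i)⟩, he⟩

end ZR

theorem corollary3p6 {F : Type u} [Field F] (D : Subring F) (Z : Set (ZR.Space D))
    (hZ : ZR.Space.generic D ∈ Z)
    (h : ∀ φ : ZR.toLRS Z hZ ⟶ (ZR.P1 D).toLocallyRingedSpace, ZR.IsDMorphism φ →
      ∃ (d : ℕ) (f : MvPolynomial (Fin 2) D), 0 < d ∧ f.IsHomogeneous d ∧
        Set.range φ.base ⊆ (ZR.P1.basicOpen f : Set (ZR.P1 D))) :
    ZR.IsPruferDomain (ZR.holomorphyRing Z) ∧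
      IsMulTorsion (CommRing.Pic (ZR.holomorphyRing Z)) ∧
      IsFractionRing (ZR.holomorphyRing Z) F := by
  have hA := ZR.hasPrincipalPowers_holomorphyRing Z hZ h
  exact ⟨hA.isPruferDomain, hA.isMulTorsion_pic, hA.isFractionRing⟩
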